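/- All Hilbert spaces are finite-dimensional. For an integer $k\ge 1$, a \emph{private state} of $\log_2 k$ secret key bits is a bipartite state, with Alice holding $A'=A_0A_1$ and Bob holding $B'=B_0B_1$, of the form \[ \gamma^k_{A'B'}=\frac1k\sum_{i,j=0}^{k-1}|ii\rangle\!\langle jj|_{A_0B_0}\otimes U_i\,\omega_{A_1B_1}U_j^\dagger , \] where $\omega_{A_1B_1}$ is a state on shield systems $A_1B_1$ of arbitrary finite dimensions and $U_0,\dots,U_{k-1}$ are unitaries on $A_1B_1$. A \emph{one-way LOCC channel} is a map $\mathcal L^{\to}=\sum_x \mathcal E_x\otimes\mathcal D_x$ (finite sum), where the $\mathcal E_x$ are completely positive maps on Alice's side whose sum is trace preserving and each $\mathcal D_x$ is a completely positive trace-preserving map on Bob's side. For a bipartite state $\rho_{AB}$ let \[ K_D^{(1),\to}(\rho_{AB})=\sup\Big\{q\log_2 k:\ \mathcal L^{\to}(\rho_{AB})=q\,|1\rangle\!\langle 1|_{X_A}\otimes\gamma^k_{A'B'}+(1-q)\,|0\rangle\!\langle 0|_{X_A}\otimes\frac{I_{A'B'}}{d_{A'}d_{B'}}\Big\}, \] the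 supremum being over $q\in[0,1]$, integers $k\ge1$, private states $\gamma^k_{A'B'}$ and one-way LOCC channels $\mathcal L^{\to}_{AB\to X_AA'B'}$, where the flag qubit $X_A$ is held by Alice. The \emph{probabilistic one-way distillable secret key} of $\rho_{AB}$ is \[ K_D^{\to}(\rho_{AB})=\liminf_{n\to\infty}\frac1n K_D^{(1),\to}(\rho_{AB}^{\otimes n}), \] where $\rho_{AB}^{\otimes n}$ is regarded as a bipartite state of $A^n$ and $B^n$. For $p\in[0,1)$ and an integer $d\ge2$, let $\Phi^d_{AB}=\frac1d\sum_{i,j=0}^{d-1}|ii\rangle\!\langle jj|$ be the maximally entangled state of Schmidt rank $d$, let $[e]_B=|e\rangle\!\langle e|$ be the erasure symbol, where $|e\rangle$ is an additional basis vector that enlarges Bob's system to dimension $d+1$ and is orthogonal to his original $d$-dimensional space, and let \[ \widetilde\Phi^{p,d}_{AB}=p\,\Phi^d_{AB}+(1-p)\,\frac{I_A}{d}\otimes[e]_B \] be the erased state. \textbf{Corollary.} For all $p\in[0,1)$ and every integer $d\ge2$, \[ K_D^{\to}\big(\widetilde\Phi^{p,d}_{AB}\big)=0 . \] Moreover, $\widetilde\Phi^{p,d}_{AB}$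 is a special case of an erased private state: up to the identification of a system with its tensor product with a one-dimensional shield system, it is equal to $p\,\gamma^d_{AB}+(1-p)\operatorname{Tr}_B[\gamma^d_{AB}]\otimes[e]_B$ for a private state $\gamma^d_{AB}$ of $\log_2 d$ secret key bits with one-dimensional shield systems. -/

import Mathlib

open scoped Kronecker ComplexOrder MatrixOrder Matrix.Norms.L2Operator

noncomputable section

namespace OneWayKey

/-- Density operators on the finite-dimensional Hilbert space with orthonormal basis indexed
by `H`. -/
def IsState {H : Type*} [Fintype H] (ρ : Matrix H H ℂ) : Prop :=
  ρ.PosSemidef ∧ ρ.trace = 1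

/-- Trace preservation of a linear map between matrix algebras. -/
def IsTracePreserving {H K : Type*} [Fintype H] [Fintype K]
    (Φ : Matrix H H ℂ →ₗ[ℂ] Matrix K K ℂ) : Prop :=
  ∀ M, (Φ M).trace = M.trace

/-- One-way LOCC channels from Alice to Bob: `L = ∑ x, E x ⊗ D x`, where `(E x)` is a quantum
instrument on Alice's side (completely positive maps with trace-preserving sum) and every `D x` is
a channel (completely positive and trace preserving) on Bob's side, which he applies on receiving
the classical message `x`. As `L` is linear, it is determined by its values on products. -/
def IsOneWayLOCC {A B A' B' : Type*}
    [Fintype A] [DecidableEq A] [Fintype B] [DecidableEq B]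
    [Fintype A'] [DecidableEq A'] [Fintype B'] [DecidableEq B']
    (L : Matrix (A × B) (A × B) ℂ →ₗ[ℂ] Matrix (A' × B') (A' × B') ℂ) : Prop :=
  ∃ (r : ℕ) (E : Fin r → CompletelyPositiveMap (Matrix A A ℂ) (Matrix A' A' ℂ))
    (D : Fin r → CompletelyPositiveMap (Matrix B B ℂ) (Matrix B' B' ℂ)),
    IsTracePreserving (∑ x, (E x).toLinearMap) ∧
    (∀ x, IsTracePreserving (D x).toLinearMap) ∧
    ∀ (M : Matrix A A ℂ) (N : Matrix B B ℂ), L (M ⊗ₖ N) = ∑ x, E x M ⊗ₖ D x N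

/-- The matrix `k⁻¹ ∑ i j, |ii⟩⟨jj| ⊗ U i ω (U j)†`, regrouped from `(A₀B₀)(A₁B₁)` to
`(A₀A₁)(B₀B₁)`: key systems `A₀`, `B₀` of dimension `k`, shield systems `A₁`, `B₁` of
dimensions `a`, `b`. -/
def privateMatrix (k a b : ℕ) (U : Fin k → Matrix.unitaryGroup (Fin a × Fin b) ℂ)
    (ω : Matrix (Fin a × Fin b) (Fin a × Fin b) ℂ) :
    Matrix ((Fin k × Fin a) × (Fin k × Fin b)) ((Fin k × Fin a) × (Fin k × Fin b)) ℂ :=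
  Matrix.reindex (Equiv.prodProdProdComm (Fin k) (Fin k) (Fin a) (Fin b))
    (Equiv.prodProdProdComm (Fin k) (Fin k) (Fin a) (Fin b))
    ((1 / (k : ℂ)) • ∑ i : Fin k, ∑ j : Fin k,
      Matrix.single (i, i) (j, j) (1 : ℂ) ⊗ₖ
        ((U i : Matrix (Fin a × Fin b) (Fin a × Fin b) ℂ) * ω *
          (U j : Matrix (Fin a × Fin b) (Fin a × Fin b) ℂ).conjTranspose))

/-- `γ` is a bipartite private state holding `log₂ k` secret key bits, with shield systems of
dimensions `a` and `b`. -/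
def IsPrivateState (k a b : ℕ)
    (γ : Matrix ((Fin k × Fin a) × (Fin k × Fin b)) ((Fin k × Fin a) × (Fin k × Fin b)) ℂ) :
    Prop :=
  1 ≤ k ∧ ∃ (U : Fin k → Matrix.unitaryGroup (Fin a × Fin b) ℂ)
    (ω : Matrix (Fin a × Fin b) (Fin a × Fin b) ℂ), IsState ω ∧ γ = privateMatrix k a b U ω

/-- The maximally mixed state. -/
def maximallyMixed (H : Type*) [Fintype H] [DecidableEq H] : Matrix H H ℂ :=
  (1 / (Fintype.card H : ℂ)) • 1

/-- `[x] ⊗ M` for a flag `x` held by Alice, grouped as `(X_A A') B'`. -/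
def flagged {A' B' : Type*} (x : Fin 2) (M : Matrix (A' × B') (A' × B') ℂ) :
    Matrix ((Fin 2 × A') × B') ((Fin 2 × A') × B') ℂ :=
  Matrix.reindex (Equiv.prodAssoc (Fin 2) A' B').symm (Equiv.prodAssoc (Fin 2) A' B').symm
    (Matrix.single x x (1 : ℂ) ⊗ₖ M)

/-- The one-shot probabilistic one-way distillable secret key: the supremum of `q log₂ k` over
all `q ∈ [0,1]`, positive integers `k`, private states `γ` of `log₂ k` secret key bits (with shields
of arbitrary finite dimension) and one-way LOCC channels that turn `ρ` into
`q [1] ⊗ γ + (1 - q) [0] ⊗ I / (d_{A'} d_{B'})`. -/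
def oneShotKey {A B : Type*} [Fintype A] [DecidableEq A] [Fintype B] [DecidableEq B]
    (ρ : Matrix (A × B) (A × B) ℂ) : EReal :=
  sSup {v : EReal | ∃ (q : ℝ) (k a b : ℕ)
    (γ : Matrix ((Fin k × Fin a) × (Fin k × Fin b)) ((Fin k × Fin a) × (Fin k × Fin b)) ℂ)
    (L : Matrix (A × B) (A × B) ℂ →ₗ[ℂ]
      Matrix ((Fin 2 × (Fin k × Fin a)) × (Fin k × Fin b))
        ((Fin 2 × (Fin k × Fin a)) × (Fin k × Fin b)) ℂ),
    q ∈ Set.Icc (0 : ℝ) 1 ∧ IsPrivateState k a b γ ∧ IsOneWayLOCC L ∧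
    L ρ = (q : ℂ) • flagged 1 γ +
      ((1 - q : ℝ) : ℂ) • flagged 0 (maximallyMixed ((Fin k × Fin a) × (Fin k × Fin b))) ∧
    v = ((q * Real.logb 2 k : ℝ) : EReal)}

/-- The `n`-fold tensor power of a bipartite operator, as a bipartite operator on `Aⁿ : Bⁿ`. -/
def tensorPower {A B : Type*} (ρ : Matrix (A × B) (A × B) ℂ) (n : ℕ) :
    Matrix ((Fin n → A) × (Fin n → B)) ((Fin n → A) × (Fin n → B)) ℂ :=
  Matrix.of fun s t => ∏ i : Fin n, ρ (s.1 i, s.2 i) (t.1 i, t.2 i)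

/-- The probabilistic one-way distillable secret key of a bipartite state. -/
def distillableKey {A B : Type*} [Fintype A] [DecidableEq A] [Fintype B] [DecidableEq B]
    (ρ : Matrix (A × B) (A × B) ℂ) : EReal :=
  Filter.liminf (fun n : ℕ => ((1 / (n : ℝ) : ℝ) : EReal) * oneShotKey (tensorPower ρ n))
    Filter.atTop

/-- The erasure symbol `[e]`, a pure state orthogonal to all states on the original system `B`;
the enlarged system has the basis `Option B`, with `none` as erasure vector. -/
def erasureSymbol (B : Type*) [DecidableEq B] : Matrix (Option B) (Option B) ℂ :=
  Matrix.single none none 1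

/-- The maximally entangled state of Schmidt rank `d`. -/
def maxEntangled (d : ℕ) : Matrix (Fin d × Fin d) (Fin d × Fin d) ℂ :=
  (1 / (d : ℂ)) • ∑ i : Fin d, ∑ j : Fin d, Matrix.single (i, i) (j, j) 1

/-- A bipartite operator on `A : B` regarded as an operator on `A : Option B`. -/
def embedBob {A B : Type*} (M : Matrix (A × B) (A × B) ℂ) :
    Matrix (A × Option B) (A × Option B) ℂ :=
  Matrix.of fun s t =>
    match s.2, t.2 with
    | some b, some b' => M (s.1, b) (t.1, b')
    | _, _ => 0

/-- Partial trace over Bob's system. -/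
def traceBob {A B : Type*} [Fintype B] (M : Matrix (A × B) (A × B) ℂ) : Matrix A A ℂ :=
  Matrix.of fun i j => ∑ b : B, M (i, b) (j, b)

/-- Bob's share of `γ` is erased with probability `1 - p`; for a private state `γ`, this is the
erased private state `p γ + (1 - p) Tr_B γ ⊗ [e]`. -/
def eraseBob {A B : Type*} [Fintype B] [DecidableEq B]
    (p : ℝ) (γ : Matrix (A × B) (A × B) ℂ) : Matrix (A × Option B) (A × Option B) ℂ :=
  (p : ℂ) • embedBob γ + ((1 - p : ℝ) : ℂ) • (traceBob γ ⊗ₖ erasureSymbol B)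

/-- The erased state `p Φ^d + (1 - p) I/d ⊗ [e]`. -/
def erasedState (p : ℝ) (d : ℕ) :
    Matrix (Fin d × Option (Fin d)) (Fin d × Option (Fin d)) ℂ :=
  (p : ℂ) • embedBob (maxEntangled d) +
    ((1 - p : ℝ) : ℂ) • (maximallyMixed (Fin d) ⊗ₖ erasureSymbol (Fin d))

/-- Identification of a system with the same system together with a one-dimensional shield. -/
def withTrivialShield (d : ℕ) : Fin d ≃ Fin d × Fin 1 :=
  (Equiv.prodUnique (Fin d) (Fin 1)).symm

end OneWayKey

end

namespace OneWayKey

open Matrix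

/-! With positive weight all of Bob's systems are erased, so `ρ^{⊗n}` dominates `c 1 ⊗ σ` with `c >
0` and `σ` a fixed state. Let `P x` be the flag-`1` block of `E x 1`. Positivity of the channel
gives `c ∑ x, P x ⊗ D x σ ≤ q γ`, and each summand lies below `q γ` separately. A private state with
`k ≥ 2` dominates no nonzero product of positive operators (`eq_zero_of_kronecker_le_privateState`),
so every `P x` vanishes. The flag-`1` block of `L 1` is then zero, and `ρ ≤ C 1` for some `C` forces
`q γ ≤ 0`, hence `q ≤ 0` (`success_le_zero`). Only `q = 0` or `k = 1` remains, so the one-shot key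
is zero for every `n`. -/

/-! ### Complete positivity and one-way LOCC maps -/

/-- Positivity of a matrix over a matrix algebra is positivity of the flattened block matrix. -/
theorem cstarMatrix_nonneg_iff {H n : Type*} [Fintype H] [DecidableEq H] [Fintype n]
    [DecidableEq n] (M : CStarMatrix n n (Matrix H H ℂ)) :
    0 ≤ M ↔ (Matrix.of fun s t : H × n => M s.2 t.2 s.1 t.1).PosSemidef := by
  constructor
  · intro h
    induction StarOrderedRing.nonneg_iff.mp h using AddSubmonoid.closure_induction with
    | mem x hx =>
      obtain ⟨S, rfl⟩ := hx
      convert Matrix.posSemidef_conjTranspose_mul_self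
        (Matrix.of fun s t : H × n => S s.2 t.2 s.1 t.1) using 1
      ext ⟨i, x⟩ ⟨j, y⟩
      simp only [Matrix.of_apply, CStarMatrix.mul_apply, CStarMatrix.star_apply, Matrix.mul_apply,
        Matrix.sum_apply, Matrix.star_apply, Matrix.conjTranspose_apply, Fintype.sum_prod_type]
      exact Finset.sum_comm
    | zero => exact Matrix.PosSemidef.zero
    | add x y hx hy hx' hy' =>
      exact (hx' (StarOrderedRing.nonneg_iff.mpr hx)).add (hy' (StarOrderedRing.nonneg_iff.mpr hy))
  · intro h
    -- A factor `S` of the flattened matrix, cut back into blocks, exhibits `M` itself as `star S *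
    -- S`.
    obtain ⟨S, hS⟩ := CStarAlgebra.nonneg_iff_eq_star_mul_self.mp h.nonneg
    have : M = star (CStarMatrix.ofMatrix
        (Matrix.of fun x y => Matrix.of fun i j => S (i, x) (j, y)) :
          CStarMatrix n n (Matrix H H ℂ)) *
        CStarMatrix.ofMatrix (Matrix.of fun x y => Matrix.of fun i j => S (i, x) (j, y)) := by
      ext x y i j
      have := congrFun (congrFun hS (i, x)) (j, y)
      simp only [Matrix.of_apply] at this
      rw [this]
      simp only [Matrix.of_apply, CStarMatrix.mul_apply, CStarMatrix.star_apply, Matrix.mul_apply,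
        Matrix.sum_apply, Matrix.star_apply, Fintype.sum_prod_type, CStarMatrix.ofMatrix_apply]
      exact Finset.sum_comm
    rw [this]
    exact star_mul_self_nonneg _

/-- The map `F ⊗ id`. -/
def amplifyLeft {H K : Type*} (n : Type*)
    (F : Matrix H H ℂ →ₗ[ℂ] Matrix K K ℂ) :
    Matrix (H × n) (H × n) ℂ →ₗ[ℂ] Matrix (K × n) (K × n) ℂ where
  toFun M := Matrix.of fun s t => F (Matrix.of fun i j => M (i, s.2) (j, t.2)) s.1 t.1
  map_add' M N := by
    ext s t
    exact congrFun (congrFun (F.map_add (Matrix.of fun i j => M (i, s.2) (j, t.2))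
      (Matrix.of fun i j => N (i, s.2) (j, t.2))) s.1) t.1
  map_smul' c M := by
    ext s t
    exact congrFun (congrFun (F.map_smul c (Matrix.of fun i j => M (i, s.2) (j, t.2))) s.1) t.1

/-- The map `id ⊗ F`. -/
def amplifyRight {H K : Type*} (n : Type*)
    (F : Matrix H H ℂ →ₗ[ℂ] Matrix K K ℂ) :
    Matrix (n × H) (n × H) ℂ →ₗ[ℂ] Matrix (n × K) (n × K) ℂ where
  toFun M := (amplifyLeft n F (M.submatrix Prod.swap Prod.swap)).submatrix Prod.swap Prod.swap
  map_add' M N := by simp [Matrix.submatrix_add]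
  map_smul' c M := by simp [Matrix.submatrix_smul]

theorem amplifyLeft_kronecker {H K n : Type*}
    (F : Matrix H H ℂ →ₗ[ℂ] Matrix K K ℂ) (M : Matrix H H ℂ) (N : Matrix n n ℂ) :
    amplifyLeft n F (M ⊗ₖ N) = F M ⊗ₖ N := by
  ext s t
  have : (Matrix.of fun i j => (M ⊗ₖ N) (i, s.2) (j, t.2)) = N s.2 t.2 • M := by
    ext i j
    simp [mul_comm]
  rw [amplifyLeft, LinearMap.coe_mk, AddHom.coe_mk, Matrix.of_apply, this, map_smul,
    Matrix.smul_apply, smul_eq_mul, Matrix.kroneckerMap_apply, mul_comm]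

theorem amplifyRight_kronecker {H K n : Type*}
    (F : Matrix H H ℂ →ₗ[ℂ] Matrix K K ℂ) (N : Matrix n n ℂ) (M : Matrix H H ℂ) :
    amplifyRight n F (N ⊗ₖ M) = N ⊗ₖ F M := by
  have : (N ⊗ₖ M).submatrix Prod.swap Prod.swap = M ⊗ₖ N := by
    ext s t
    simp [mul_comm]
  simp only [amplifyRight, LinearMap.coe_mk, AddHom.coe_mk, this, amplifyLeft_kronecker]
  ext s t
  simp [mul_comm]

section Positivity

variable {H K n : Type*} [Fintype H] [DecidableEq H] [Fintype K] [DecidableEq K] [Fintype n]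

theorem amplifyLeft_posSemidef
    (F : CompletelyPositiveMap (Matrix H H ℂ) (Matrix K K ℂ)) {M : Matrix (H × n) (H × n) ℂ}
    (hM : M.PosSemidef) : (amplifyLeft n F.toLinearMap M).PosSemidef := by
  classical
  exact (cstarMatrix_nonneg_iff _).mp (F.map_cstarMatrix_nonneg
    (CStarMatrix.ofMatrix (Matrix.of fun x y => Matrix.of fun i j => M (i, x) (j, y)))
    ((cstarMatrix_nonneg_iff _).mpr hM))

theorem amplifyRight_posSemidef
    (F : CompletelyPositiveMap (Matrix H H ℂ) (Matrix K K ℂ)) {M : Matrix (n × H) (n × H) ℂ}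
    (hM : M.PosSemidef) : (amplifyRight n F.toLinearMap M).PosSemidef :=
  (amplifyLeft_posSemidef F (hM.submatrix Prod.swap)).submatrix Prod.swap

/-- Amplification by a one-dimensional ancilla. -/
theorem completelyPositiveMap_posSemidef
    (F : CompletelyPositiveMap (Matrix H H ℂ) (Matrix K K ℂ)) {M : Matrix H H ℂ}
    (hM : M.PosSemidef) : (F M).PosSemidef :=
  (amplifyLeft_posSemidef F (hM.submatrix (Prod.fst : H × Unit → H))).submatrix
    (fun k => (k, ()))

end Positivity

/-- Matrix units of `A × B` are products of matrix units. This recovers `L` from the product formula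
in `IsOneWayLOCC`. -/
theorem ext_kronecker {A B V : Type*} [Finite A] [Finite B]
    [AddCommMonoid V] [Module ℂ V]
    {L L' : Matrix (A × B) (A × B) ℂ →ₗ[ℂ] V} (h : ∀ M N, L (M ⊗ₖ N) = L' (M ⊗ₖ N)) : L = L' := by
  classical
  refine Matrix.ext_linearMap ℂ fun s t => LinearMap.ext fun c => ?_
  have := h (Matrix.single s.1 t.1 c) (Matrix.single s.2 t.2 1)
  rwa [Matrix.single_kronecker_single, mul_one] at this

/-- Each `E x ⊗ D x` factors as `(E x ⊗ id) ∘ (id ⊗ D x)`, and both factors preserve positivity. -/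
theorem IsOneWayLOCC.posSemidef {A B A' B' : Type*}
    [Fintype A] [DecidableEq A] [Fintype B] [DecidableEq B]
    [Fintype A'] [DecidableEq A'] [Fintype B'] [DecidableEq B']
    {L : Matrix (A × B) (A × B) ℂ →ₗ[ℂ] Matrix (A' × B') (A' × B') ℂ} (hL : IsOneWayLOCC L)
    {M : Matrix (A × B) (A × B) ℂ} (hM : M.PosSemidef) : (L M).PosSemidef := by
  obtain ⟨r, E, D, -, -, h⟩ := hL
  have : L = ∑ x, amplifyLeft B' (E x).toLinearMap ∘ₗ amplifyRight A (D x).toLinearMap := by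
    refine ext_kronecker fun M N => ?_
    simp only [h, LinearMap.sum_apply, LinearMap.comp_apply, amplifyRight_kronecker,
      amplifyLeft_kronecker]
    rfl
  rw [this, LinearMap.sum_apply]
  exact Matrix.posSemidef_sum _ fun x _ =>
    amplifyLeft_posSemidef (E x) (amplifyRight_posSemidef (D x) hM)

/-- The completely positive map `M ↦ tr M • Z`. -/
noncomputable def tracePrepare (H : Type*) {K : Type*} [Fintype H] [DecidableEq H] [Fintype K] [DecidableEq K]
    (Z : Matrix K K ℂ) (hZ : Z.PosSemidef) :
    CompletelyPositiveMap (Matrix H H ℂ) (Matrix K K ℂ) where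
  toLinearMap := (Matrix.traceLinearMap H ℂ ℂ).smulRight Z
  map_cstarMatrix_nonneg' k M hM := by
    rw [cstarMatrix_nonneg_iff] at hM ⊢
    -- The amplified map sends `M` to `Z` tensored with the partial trace of `M` over `H`, a sum of
    -- principal submatrices.
    have hT : (∑ a : H, (Matrix.of fun s t : H × Fin k => M s.2 t.2 s.1 t.1).submatrix
        (fun x => (a, x)) (fun x => (a, x))).PosSemidef :=
      Matrix.posSemidef_sum _ fun a _ => hM.submatrix _
    refine (congrArg Matrix.PosSemidef ?_).mp (hZ.kronecker hT)
    ext s t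
    simp [Matrix.sum_apply, Matrix.trace, mul_comm]

/-! ### Private states and product operators -/

/-- A basis vector on which the quadratic form vanishes lies in the kernel, so its whole column is
zero. -/
theorem posSemidef_apply_eq_zero {H : Type*} [Fintype H] [DecidableEq H] {M : Matrix H H ℂ}
    (hM : M.PosSemidef) {i : H} (hi : M i i = 0) (j : H) : M j i = 0 := by
  have h := (hM.dotProduct_mulVec_zero_iff (Pi.single i 1)).mp (by simp [hi])
  simpa using congrFun h j

theorem privateMatrix_apply {k a b : ℕ} (U : Fin k → Matrix.unitaryGroup (Fin a × Fin b) ℂ)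
    (ω : Matrix (Fin a × Fin b) (Fin a × Fin b) ℂ) (s t : (Fin k × Fin a) × (Fin k × Fin b)) :
    privateMatrix k a b U ω s t = if s.1.1 = s.2.1 ∧ t.1.1 = t.2.1 then
      1 / (k : ℂ) * ((U s.1.1 : Matrix (Fin a × Fin b) (Fin a × Fin b) ℂ) * ω *
        (U t.1.1 : Matrix (Fin a × Fin b) (Fin a × Fin b) ℂ)ᴴ) (s.1.2, s.2.2) (t.1.2, t.2.2)
      else 0 := by
  obtain ⟨⟨i, x⟩, ⟨j, y⟩⟩ := s
  obtain ⟨⟨i', x'⟩, ⟨j', y'⟩⟩ := t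
  simp only [privateMatrix, Matrix.reindex_apply, Matrix.submatrix_apply,
    Equiv.prodProdProdComm_symm, Equiv.prodProdProdComm_apply, Matrix.smul_apply, Matrix.sum_apply,
    Matrix.kroneckerMap_apply, Matrix.single_apply, Prod.mk.injEq, smul_eq_mul, ite_mul, one_mul,
    zero_mul]
  split_ifs with h
  · obtain ⟨rfl, rfl⟩ := h
    rw [Finset.sum_eq_single i, Finset.sum_eq_single i']
    · simp
    · intro c _ hc
      simp [hc]
    · simp
    · intro c _ hc
      simp [hc]
    · simp
  · rw [Finset.sum_eq_zero, mul_zero]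
    intro c _
    refine Finset.sum_eq_zero fun c' _ => if_neg ?_
    rintro ⟨⟨rfl, rfl⟩, rfl, rfl⟩
    exact h ⟨rfl, rfl⟩

theorem IsPrivateState.trace_eq_one {k a b : ℕ}
    {γ : Matrix ((Fin k × Fin a) × (Fin k × Fin b)) ((Fin k × Fin a) × (Fin k × Fin b)) ℂ}
    (hγ : IsPrivateState k a b γ) : γ.trace = 1 := by
  obtain ⟨hk, U, ω, hω, rfl⟩ := hγ
  have hk' : (k : ℂ) ≠ 0 := by exact_mod_cast (by omega : k ≠ 0)
  have hU (i : Fin k) : ((U i : Matrix (Fin a × Fin b) (Fin a × Fin b) ℂ) * ω *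
      (U i : Matrix (Fin a × Fin b) (Fin a × Fin b) ℂ)ᴴ).trace = 1 := by
    rw [Matrix.trace_mul_cycle, ← Matrix.star_eq_conjTranspose,
      Matrix.UnitaryGroup.star_mul_self, Matrix.one_mul, hω.2]
  rw [privateMatrix, Matrix.reindex_apply]
  have htr {m n : Type} [Fintype m] [Fintype n] (e : m ≃ n) (M : Matrix n n ℂ) :
      (M.submatrix e e).trace = M.trace := by
    simpa [Matrix.trace] using e.sum_comp fun i => M i i
  rw [htr]
  simp only [Matrix.trace_smul, Matrix.trace_sum, Matrix.trace_kronecker]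
  have (i j : Fin k) : (Matrix.single (i, i) (j, j) (1 : ℂ)).trace = if i = j then 1 else 0 := by
    split_ifs with h
    · subst h
      simp
    · exact Matrix.trace_single_eq_of_ne _ _ _ (by simpa using h)
  simp only [this, ite_mul, one_mul, zero_mul, Finset.sum_ite_eq, Finset.mem_univ, if_true, hU]
  simp [hk']

/-- No nonzero product of positive operators lies below a multiple of a private state with at
least one secret key bit. -/
theorem eq_zero_of_kronecker_le_privateState {k a b : ℕ} (hk : 2 ≤ k)
    {γ : Matrix ((Fin k × Fin a) × (Fin k × Fin b)) ((Fin k × Fin a) × (Fin k × Fin b)) ℂ}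
    (hγ : IsPrivateState k a b γ) {q : ℂ}
    {P : Matrix (Fin k × Fin a) (Fin k × Fin a) ℂ} {Q : Matrix (Fin k × Fin b) (Fin k × Fin b) ℂ}
    (hP : P.PosSemidef) (hQ : Q.PosSemidef) (hQ1 : Q.trace ≠ 0)
    (h : (q • γ - P ⊗ₖ Q).PosSemidef) : P = 0 := by
  obtain ⟨-, U, ω, hω, rfl⟩ := hγ
  obtain ⟨⟨j, y⟩, hjy⟩ : ∃ s, Q s s ≠ 0 := by
    by_contra! hc
    exact hQ1 (Finset.sum_eq_zero fun s _ => hc s)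
  have hQpos : 0 < Q (j, y) (j, y) := lt_of_le_of_ne hQ.diag_nonneg (Ne.symm hjy)
  -- The private state has zero diagonal where the two keys differ. Since Bob's key can be `j`,
  -- Alice's key can only be `j`.
  have hoff (i : Fin k) (hi : i ≠ j) (x : Fin a) : P (i, x) (i, x) = 0 := by
    have h1 := h.diag_nonneg (i := ((i, x), (j, y)))
    simp only [Matrix.sub_apply, Matrix.smul_apply, privateMatrix_apply, hi, false_and, if_false,
      smul_zero, zero_sub, Matrix.kroneckerMap_apply, Left.nonneg_neg_iff] at h1
    have h2 : P (i, x) (i, x) * Q (j, y) (j, y) = 0 :=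
      le_antisymm h1 (mul_nonneg hP.diag_nonneg hQpos.le)
    exact (mul_eq_zero.mp h2).resolve_right hjy
  obtain ⟨l, hl⟩ : ∃ l : Fin k, l ≠ j :=
    haveI : Nontrivial (Fin k) := Fin.nontrivial_iff_two_le.mpr hk
    exists_ne j
  let emb (i : Fin k) (s : Fin a × Fin b) : (Fin k × Fin a) × (Fin k × Fin b) :=
    ((i, s.1), (i, s.2))
  let T := (P ⊗ₖ Q).submatrix (emb j) (emb j)
  let u (i : Fin k) : Matrix (Fin a × Fin b) (Fin a × Fin b) ℂ := U i
  have hu (i : Fin k) : (u i)ᴴ * u i = 1 := Matrix.UnitaryGroup.star_mul_self (U i)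
  have hu' (i : Fin k) : u i * (u i)ᴴ = 1 := mul_eq_one_comm.mp (hu i)
  have hcol (i : Fin k) (x : Fin a) (s : Fin k × Fin a) : P s (l, x) = 0 :=
    posSemidef_apply_eq_zero hP (hoff l hl x) s
  have hrow (i : Fin k) (x : Fin a) (s : Fin k × Fin a) : P (l, x) s = 0 := by
    rw [← hP.1.apply, hcol i x s, star_zero]
  -- On the key values `jj` and `ll` the private part is a scaled `V ω V†` with `V` the column `(u
  -- j, u l)`, while the product operator survives only in the `jj` corner.
  have hblock : (q • privateMatrix k a b U ω - P ⊗ₖ Q).submatrix (Sum.elim (emb j) (emb l))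
      (Sum.elim (emb j) (emb l)) =
      fromRows (u j) (u l) * ((q * (1 / (k : ℂ))) • ω) * fromCols (u j)ᴴ (u l)ᴴ -
        fromBlocks T 0 0 0 := by
    rw [fromRows_mul, fromRows_mul_fromCols]
    ext s t
    rcases s with s | s <;> rcases t with t | t <;>
      simp [emb, T, u, privateMatrix_apply, hcol j, hrow j, mul_assoc]
  -- The column `(u j, -u l)` is orthogonal to `V` because `u j` and `u l` are unitary. Compressing
  -- with it kills the private part and leaves `-(u j)† T (u j)`.
  have h3 := (h.submatrix (Sum.elim (emb j) (emb l))).conjTranspose_mul_mul_same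
    (fromRows (u j) (-u l))
  have h4 : (fromRows (u j) (-u l))ᴴ * fromRows (u j) (u l) = 0 := by
    rw [conjTranspose_fromRows_eq_fromCols_conjTranspose, fromCols_mul_fromRows]
    simp [hu]
  rw [hblock, Matrix.mul_sub, Matrix.sub_mul, ← Matrix.mul_assoc, ← Matrix.mul_assoc, h4,
    Matrix.zero_mul, Matrix.zero_mul, Matrix.zero_mul, conjTranspose_fromRows_eq_fromCols_conjTranspose,
    fromCols_mul_fromBlocks, fromCols_mul_fromRows] at h3
  have h5 := h3.mul_mul_conjTranspose_same (u j)
  have h6 : u j * (0 - ((u j)ᴴ * T * u j)) * (u j)ᴴ = - T := by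
    rw [zero_sub, Matrix.mul_neg, Matrix.neg_mul, ← Matrix.mul_assoc, ← Matrix.mul_assoc, hu',
      Matrix.one_mul, Matrix.mul_assoc, hu', Matrix.mul_one]
  have hT : (-T).PosSemidef := by
    rw [← h6]
    simpa using h5
  refine hP.trace_eq_zero_iff.mp (Finset.sum_eq_zero fun s _ => ?_)
  obtain ⟨i, x⟩ := s
  rw [Matrix.diag_apply]
  by_cases hi : i = j
  · subst hi
    have h7 := hT.diag_nonneg (i := (x, y))
    simp only [T, emb, Matrix.neg_apply, Matrix.submatrix_apply, Matrix.kroneckerMap_apply,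
      Left.nonneg_neg_iff] at h7
    have h8 : P (i, x) (i, x) * Q (i, y) (i, y) = 0 :=
      le_antisymm h7 (mul_nonneg hP.diag_nonneg hQpos.le)
    exact (mul_eq_zero.mp h8).resolve_right hjy
  · exact hoff i hi x

/-! ### Vanishing of the success probability -/

/-- The block of an operator in which Alice's flag is `1`. -/
def flagBlock {A' B' : Type*} (M : Matrix ((Fin 2 × A') × B') ((Fin 2 × A') × B') ℂ) :
    Matrix (A' × B') (A' × B') ℂ :=
  M.submatrix (fun s => ((1, s.1), s.2)) (fun s => ((1, s.1), s.2))

theorem flagBlock_flagged {A' B' : Type*} (q r : ℂ) (M N : Matrix (A' × B') (A' × B') ℂ) :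
    flagBlock (q • flagged 1 M + r • flagged 0 N) = q • M := by
  ext s t
  simp [flagBlock, flagged]

theorem exists_smul_one_sub_posSemidef {H : Type*} [Fintype H] [DecidableEq H] {M : Matrix H H ℂ}
    (hM : M.PosSemidef) : ∃ C : ℝ, ((C : ℂ) • (1 : Matrix H H ℂ) - M).PosSemidef := by
  refine ⟨‖M‖, ?_⟩
  have h : M ≤ algebraMap ℝ (Matrix H H ℂ) ‖M‖ := IsSelfAdjoint.le_algebraMap_norm_self hM.1
  have h2 : algebraMap ℝ (Matrix H H ℂ) ‖M‖ = (‖M‖ : ℂ) • (1 : Matrix H H ℂ) := by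
    rw [Algebra.algebraMap_eq_smul_one]
    ext i j
    simp
  rwa [h2, Matrix.le_iff] at h

/-- If `ρ` has a component of the form `c I ⊗ σ`, no secret key bit can be distilled from it
probabilistically by one-way LOCC. -/
theorem success_le_zero {A B : Type*} [Fintype A] [DecidableEq A] [Fintype B] [DecidableEq B]
    {ρ : Matrix (A × B) (A × B) ℂ} (hρ : ρ.PosSemidef) {σ : Matrix B B ℂ} (hσ : IsState σ)
    {c : ℝ} (hc : 0 < c) (hcσ : (ρ - (c : ℂ) • ((1 : Matrix A A ℂ) ⊗ₖ σ)).PosSemidef)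
    {q : ℝ} {k a b : ℕ} (hk : 2 ≤ k)
    {γ : Matrix ((Fin k × Fin a) × (Fin k × Fin b)) ((Fin k × Fin a) × (Fin k × Fin b)) ℂ}
    (hγ : IsPrivateState k a b γ)
    {L : Matrix (A × B) (A × B) ℂ →ₗ[ℂ]
      Matrix ((Fin 2 × (Fin k × Fin a)) × (Fin k × Fin b))
        ((Fin 2 × (Fin k × Fin a)) × (Fin k × Fin b)) ℂ} (hL : IsOneWayLOCC L)
    {r : ℂ} {τ : Matrix ((Fin k × Fin a) × (Fin k × Fin b)) ((Fin k × Fin a) × (Fin k × Fin b)) ℂ}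
    (h : L ρ = (q : ℂ) • flagged 1 γ + r • flagged 0 τ) : q ≤ 0 := by
  obtain ⟨s, E, D, -, hD, hED⟩ := id hL
  let P (x : Fin s) : Matrix (Fin k × Fin a) (Fin k × Fin a) ℂ :=
    (E x 1).submatrix (Prod.mk 1) (Prod.mk 1)
  have hP (x : Fin s) : (P x).PosSemidef :=
    (completelyPositiveMap_posSemidef (E x) Matrix.PosSemidef.one).submatrix _
  have hblock (N : Matrix B B ℂ) : flagBlock (L (1 ⊗ₖ N)) = ∑ x, P x ⊗ₖ D x N := by
    rw [hED]
    ext s t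
    simp [flagBlock, P, Matrix.sum_apply]
  have hc' : (0 : ℂ) ≤ c := by exact_mod_cast hc.le
  have hDσ (x : Fin s) : (D x σ).PosSemidef := completelyPositiveMap_posSemidef (D x) hσ.1
  have h1 : ((q : ℂ) • γ - (c : ℂ) • ∑ x, P x ⊗ₖ D x σ).PosSemidef := by
    have := (hL.posSemidef hcσ).submatrix
      (fun s : (Fin k × Fin a) × (Fin k × Fin b) => (((1 : Fin 2), s.1), s.2))
    rw [map_sub, map_smul, h] at this
    rw [← flagBlock_flagged (q : ℂ) r γ τ, ← hblock]
    exact this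
  -- The other summands are positive, so adding them back isolates a single product operator below
  -- `q γ`.
  have hP0 (x : Fin s) : P x = 0 := by
    have h2 : ((q : ℂ) • γ - ((c : ℂ) • P x) ⊗ₖ D x σ).PosSemidef := by
      have h3 : ((c : ℂ) • ∑ y ∈ Finset.univ.erase x, P y ⊗ₖ D y σ).PosSemidef :=
        (Matrix.posSemidef_sum _ fun y _ => (hP y).kronecker (hDσ y)).smul hc'
      convert h1.add h3 using 1
      rw [← Finset.add_sum_erase _ _ (Finset.mem_univ x), smul_add, Matrix.smul_kronecker]
      abel
    have h4 := eq_zero_of_kronecker_le_privateState hk hγ ((hP x).smul hc') (hDσ x)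
      (by rw [show (D x σ).trace = σ.trace from hD x σ, hσ.2]; exact one_ne_zero) h2
    exact (smul_eq_zero.mp h4).resolve_left (by exact_mod_cast hc.ne')
  -- Domination by `C 1` carries the vanishing of the flag-`1` block from `L 1` over to `L ρ`.
  obtain ⟨C, hC⟩ := exists_smul_one_sub_posSemidef hρ
  have h5 : (-((q : ℂ) • γ)).PosSemidef := by
    have := (hL.posSemidef hC).submatrix
      (fun s : (Fin k × Fin a) × (Fin k × Fin b) => (((1 : Fin 2), s.1), s.2))
    have h6 : flagBlock (L 1) = 0 := by
      rw [← Matrix.one_kronecker_one, hblock]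
      simp [hP0]
    rw [map_sub, map_smul, h] at this
    rw [← flagBlock_flagged (q : ℂ) r γ τ, ← zero_sub, ← smul_zero (C : ℂ), ← h6]
    exact this
  have h7 := h5.trace_nonneg
  rw [Matrix.trace_neg, Matrix.trace_smul, hγ.trace_eq_one, smul_eq_mul, mul_one,
    Left.nonneg_neg_iff] at h7
  exact_mod_cast h7

/-! ### The one-shot key -/

/-- The channel that discards its input and prepares a product state. -/
theorem isOneWayLOCC_prepare {A B A' B' : Type*}
    [Fintype A] [DecidableEq A] [Fintype B] [DecidableEq B]
    [Fintype A'] [DecidableEq A'] [Fintype B'] [DecidableEq B']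
    {σ : Matrix A' A' ℂ} {τ : Matrix B' B' ℂ} (hσ : IsState σ) (hτ : IsState τ) :
    IsOneWayLOCC ((Matrix.traceLinearMap (A × B) ℂ ℂ).smulRight (σ ⊗ₖ τ)) := by
  refine ⟨1, fun _ => tracePrepare A σ hσ.1, fun _ => tracePrepare B τ hτ.1, ?_, ?_, ?_⟩
  · intro M
    simp [tracePrepare, hσ.2]
  · intro _ M
    simp [tracePrepare, hτ.2]
  · intro M N
    have h1 : tracePrepare A σ hσ.1 M = M.trace • σ := rfl
    have h2 : tracePrepare B τ hτ.1 N = N.trace • τ := rfl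
    simp [Matrix.trace_kronecker, h1, h2, Matrix.smul_kronecker, Matrix.kronecker_smul, smul_smul,
      mul_comm]

theorem isState_single {H : Type*} [Fintype H] [DecidableEq H] (i : H) :
    IsState (Matrix.single i i (1 : ℂ)) := by
  refine ⟨?_, by simp⟩
  rw [← Matrix.diagonal_single]
  refine Matrix.PosSemidef.diagonal ?_
  intro j
  by_cases h : j = i
  · subst h; simp
  · simp [h]

/-- Preparing a trivial private state with `k = 1` always succeeds and contributes `log₂ 1 = 0`. -/
theorem zero_le_oneShotKey {A B : Type*} [Fintype A] [DecidableEq A] [Fintype B] [DecidableEq B]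
    {ρ : Matrix (A × B) (A × B) ℂ} (hρ : ρ.trace = 1) : 0 ≤ oneShotKey ρ := by
  refine le_sSup ⟨1, 1, 1, 1, 1, (Matrix.traceLinearMap (A × B) ℂ ℂ).smulRight
    (Matrix.single (1, (0, 0)) (1, (0, 0)) 1 ⊗ₖ Matrix.single (0, 0) (0, 0) 1), by simp,
    ⟨le_rfl, fun _ => 1, 1, ⟨Matrix.PosSemidef.one, by simp⟩, ?_⟩,
    isOneWayLOCC_prepare (isState_single _) (isState_single _), ?_, by simp⟩
  · ext s t
    rw [privateMatrix_apply]
    have hs : s.1.1 = s.2.1 := Subsingleton.elim _ _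
    have ht : t.1.1 = t.2.1 := Subsingleton.elim _ _
    rw [if_pos ⟨hs, ht⟩, Subsingleton.elim s t]
    simp
  · ext s t
    obtain ⟨⟨f, i, x⟩, j, y⟩ := s
    obtain ⟨⟨f', i', x'⟩, j', y'⟩ := t
    rw [Subsingleton.elim i 0, Subsingleton.elim x 0, Subsingleton.elim j 0, Subsingleton.elim y 0,
      Subsingleton.elim i' 0, Subsingleton.elim x' 0, Subsingleton.elim j' 0,
      Subsingleton.elim y' 0]
    simp [hρ, flagged, Matrix.single_apply]

theorem oneShotKey_eq_zero {A B : Type*} [Fintype A] [DecidableEq A] [Fintype B] [DecidableEq B]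
    {ρ : Matrix (A × B) (A × B) ℂ} (hρ : IsState ρ) {σ : Matrix B B ℂ} (hσ : IsState σ)
    {c : ℝ} (hc : 0 < c) (hcσ : (ρ - (c : ℂ) • ((1 : Matrix A A ℂ) ⊗ₖ σ)).PosSemidef) :
    oneShotKey ρ = 0 := by
  refine le_antisymm (sSup_le ?_) (zero_le_oneShotKey hρ.2)
  rintro v ⟨q, k, a, b, γ, L, hq, hγ, hL, h, rfl⟩
  rcases (show k = 1 ∨ 2 ≤ k by have := hγ.1; omega) with rfl | hk
  · simp
  · have hq0 : q = 0 := le_antisymm (success_le_zero hρ.1 hσ hc hcσ hk hγ hL h) hq.1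
    simp [hq0]

/-! ### Tensor powers and the erased state -/

theorem tensorPower_posSemidef {A B : Type*} [Fintype A] [Fintype B]
    {ρ : Matrix (A × B) (A × B) ℂ} (hρ : ρ.PosSemidef) (n : ℕ) :
    (tensorPower ρ n).PosSemidef := by
  -- Partial products are Hadamard products of pullbacks of `ρ`, so the Schur product theorem drives
  -- the induction.
  have h (S : Finset (Fin n)) : (Matrix.of fun s t : (Fin n → A) × (Fin n → B) =>
      ∏ i ∈ S, ρ (s.1 i, s.2 i) (t.1 i, t.2 i)).PosSemidef := by
    induction S using Finset.cons_induction with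
    | empty =>
      convert Matrix.posSemidef_vecMulVec_self_star
        (fun _ : (Fin n → A) × (Fin n → B) => (1 : ℂ)) using 1
      ext s t
      simp [Matrix.vecMulVec_apply]
    | cons i S hi ih =>
      refine (congrArg Matrix.PosSemidef ?_).mp
        ((hρ.submatrix fun s : (Fin n → A) × (Fin n → B) => (s.1 i, s.2 i)).hadamard ih)
      ext s t
      simp [-Finset.cons_eq_insert, Finset.prod_cons]
  exact h Finset.univ

theorem trace_tensorPower {A B : Type*} [Fintype A] [Fintype B]
    (ρ : Matrix (A × B) (A × B) ℂ) (n : ℕ) : (tensorPower ρ n).trace = ρ.trace ^ n := by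
  simp only [Matrix.trace, Matrix.diag_apply, Fintype.sum_pow]
  exact ((Equiv.arrowProdEquivProdArrow (Fin n) (fun _ => A) (fun _ => B)).sum_comp
    fun s => tensorPower ρ n s s).symm

theorem IsState.tensorPower {A B : Type*} [Fintype A] [Fintype B]
    {ρ : Matrix (A × B) (A × B) ℂ} (hρ : IsState ρ) (n : ℕ) : IsState (tensorPower ρ n) :=
  ⟨tensorPower_posSemidef hρ.1 n, by rw [trace_tensorPower, hρ.2, one_pow]⟩

theorem maxEntangled_apply (d : ℕ) (s t : Fin d × Fin d) :
    maxEntangled d s t = if s.1 = s.2 ∧ t.1 = t.2 then 1 / (d : ℂ) else 0 := by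
  obtain ⟨i, j⟩ := s
  obtain ⟨i', j'⟩ := t
  simp only [maxEntangled, Matrix.smul_apply, Matrix.sum_apply, Matrix.single_apply,
    Prod.mk.injEq, smul_eq_mul]
  split_ifs with h
  · obtain ⟨rfl, rfl⟩ := h
    rw [Finset.sum_eq_single i, Finset.sum_eq_single i']
    · simp
    · intro c _ hc
      simp [hc]
    · simp
    · intro c _ hc
      simp [hc]
    · simp
  · rw [Finset.sum_eq_zero, mul_zero]
    intro c _
    refine Finset.sum_eq_zero fun c' _ => if_neg ?_
    rintro ⟨⟨rfl, rfl⟩, rfl, rfl⟩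
    exact h ⟨rfl, rfl⟩

theorem erasedState_none_none (p : ℝ) (d : ℕ) (i j : Fin d) :
    erasedState p d (i, none) (j, none) =
      (((1 - p) / d : ℝ) : ℂ) * (1 : Matrix (Fin d) (Fin d) ℂ) i j := by
  simp [erasedState, embedBob, maximallyMixed, erasureSymbol, div_eq_mul_inv, mul_assoc]

theorem erasedState_none_some (p : ℝ) (d : ℕ) (i j b : Fin d) :
    erasedState p d (i, none) (j, some b) = 0 := by
  simp [erasedState, embedBob, erasureSymbol]

theorem erasedState_some_none (p : ℝ) (d : ℕ) (i j b : Fin d) :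
    erasedState p d (i, some b) (j, none) = 0 := by
  simp [erasedState, embedBob, erasureSymbol]

theorem isState_erasedState {p : ℝ} (hp : p ∈ Set.Ico (0 : ℝ) 1) {d : ℕ} (hd : d ≠ 0) :
    IsState (erasedState p d) := by
  have hd' : (d : ℂ) ≠ 0 := by exact_mod_cast hd
  have hdinv : (0 : ℂ) ≤ 1 / (d : ℂ) := by simp
  constructor
  · refine Matrix.PosSemidef.add (Matrix.PosSemidef.smul ?_ ?_) (Matrix.PosSemidef.smul ?_ ?_)
    -- The embedded `Φ^d` is `1/d` times the projector onto the unnormalized vector `∑ i, |i⟩|i⟩`.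
    · convert (Matrix.posSemidef_vecMulVec_self_star
        (fun s : Fin d × Option (Fin d) => if s.2 = some s.1 then (1 : ℂ) else 0)).smul hdinv using 1
      ext ⟨i, x⟩ ⟨j, y⟩
      rcases x with _ | x <;> rcases y with _ | y <;>
        simp [embedBob, maxEntangled_apply, Matrix.vecMulVec_apply, eq_comm, ← ite_and, and_comm]
    · exact_mod_cast hp.1
    · refine Matrix.PosSemidef.kronecker (Matrix.PosSemidef.one.smul ?_) (isState_single none).1
      simpa only [Fintype.card_fin] using hdinv
    · exact_mod_cast sub_nonneg.mpr hp.2.le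
  · rw [erasedState, Matrix.trace_add, Matrix.trace_smul, Matrix.trace_smul,
      Matrix.trace_kronecker]
    have h1 : (embedBob (maxEntangled d)).trace = 1 := by
      simp [Matrix.trace, Fintype.sum_prod_type, embedBob, maxEntangled_apply, hd']
    have h2 : (maximallyMixed (Fin d)).trace = 1 := by
      simp [maximallyMixed, hd']
    have h3 : (erasureSymbol (Fin d)).trace = 1 := (isState_single none).2
    rw [h1, h2, h3]
    simp

/-- The component of `ρ^{⊗n}` in which all of Bob's systems are erased. -/
theorem tensorPower_erasedState_sub_posSemidef {p : ℝ} (hp : p ∈ Set.Ico (0 : ℝ) 1) {d : ℕ}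
    (hd : d ≠ 0) (n : ℕ) :
    (tensorPower (erasedState p d) n - ((((1 - p) / d) ^ n : ℝ) : ℂ) •
      ((1 : Matrix (Fin n → Fin d) (Fin n → Fin d) ℂ) ⊗ₖ
        Matrix.single (fun _ => none) (fun _ => none) 1)).PosSemidef := by
  classical
  -- The Hadamard product with this 0/1 rank-one matrix compresses to the case where not all of
  -- Bob's systems are erased. Entries linking that case to total erasure are already zero, so the
  -- compression equals the difference.
  refine (congrArg Matrix.PosSemidef ?_).mp
    ((tensorPower_posSemidef (isState_erasedState hp hd).1 n).hadamard
      (Matrix.posSemidef_vecMulVec_self_star fun s : (Fin n → Fin d) × (Fin n → Option (Fin d)) =>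
        if s.2 = fun _ => none then (0 : ℂ) else 1))
  symm
  ext ⟨v, x⟩ ⟨w, y⟩
  simp only [Matrix.sub_apply, Matrix.smul_apply, Matrix.kroneckerMap_apply, Matrix.single_apply,
    Matrix.hadamard_apply, Matrix.vecMulVec_apply, smul_eq_mul, Pi.star_apply]
  by_cases hx : x = fun _ => none <;> by_cases hy : y = fun _ => none
  · subst hx hy
    have : (1 : Matrix (Fin n → Fin d) (Fin n → Fin d) ℂ) v w =
        ∏ i, (1 : Matrix (Fin d) (Fin d) ℂ) (v i) (w i) := by
      simp only [Matrix.one_apply, funext_iff, Finset.prod_ite_zero, Finset.prod_const_one,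
        Finset.mem_univ, true_imp_iff]
    simp [tensorPower, erasedState_none_none, Finset.prod_mul_distrib, this, div_pow]
  · obtain ⟨i, hi⟩ : ∃ i, y i ≠ none := by
      by_contra! h
      exact hy (funext h)
    obtain ⟨b, hb⟩ := Option.ne_none_iff_exists'.mp hi
    subst hx
    have : tensorPower (erasedState p d) n (v, fun _ => none) (w, y) = 0 :=
      Finset.prod_eq_zero (Finset.mem_univ i) (by simp [hb, erasedState_none_some])
    simp [this, Ne.symm hy]
  · obtain ⟨i, hi⟩ : ∃ i, x i ≠ none := by
      by_contra! h
      exact hx (funext h)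
    obtain ⟨b, hb⟩ := Option.ne_none_iff_exists'.mp hi
    subst hy
    have : tensorPower (erasedState p d) n (v, x) (w, fun _ => none) = 0 :=
      Finset.prod_eq_zero (Finset.mem_univ i) (by simp [hb, erasedState_some_none])
    simp [this, Ne.symm hx]
  · simp [hx, hy, Ne.symm hx]

theorem distillableKey_erasedState {p : ℝ} (hp : p ∈ Set.Ico (0 : ℝ) 1) {d : ℕ} (hd : d ≠ 0) :
    distillableKey (erasedState p d) = 0 := by
  have hd' : (0 : ℝ) < d := by exact_mod_cast Nat.pos_of_ne_zero hd
  have h (n : ℕ) : oneShotKey (tensorPower (erasedState p d) n) = 0 :=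
    oneShotKey_eq_zero ((isState_erasedState hp hd).tensorPower n) (isState_single _)
      (pow_pos (div_pos (sub_pos.mpr hp.2) hd') n)
      (tensorPower_erasedState_sub_posSemidef hp hd n)
  simp [distillableKey, h]

/-- With trivial unitaries and one-dimensional shields the private state is `Φ^d`, whose marginal on
Alice's side is `I/d`. -/
theorem erasedState_eq_eraseBob (p : ℝ) (d : ℕ) :
    Matrix.reindex
      (Equiv.prodCongr (withTrivialShield d) (Equiv.optionCongr (withTrivialShield d)))
      (Equiv.prodCongr (withTrivialShield d) (Equiv.optionCongr (withTrivialShield d)))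
      (erasedState p d) = eraseBob p (privateMatrix d 1 1 (fun _ => 1) 1) := by
  ext ⟨⟨i, z⟩, x⟩ ⟨⟨j, z'⟩, y⟩
  rw [Subsingleton.elim z 0, Subsingleton.elim z' 0]
  rcases x with _ | ⟨x, w⟩ <;> rcases y with _ | ⟨y, w'⟩
  · simp [withTrivialShield, erasedState, eraseBob, embedBob, erasureSymbol, traceBob,
      privateMatrix_apply, maximallyMixed, Matrix.one_apply, Fintype.sum_prod_type]
    rw [Finset.sum_eq_single i (fun c _ hc => if_neg fun h => hc h.1.symm) (by simp)]
    simp [eq_comm]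
  · simp [withTrivialShield, erasedState, eraseBob, embedBob, erasureSymbol]
  · simp [withTrivialShield, erasedState, eraseBob, embedBob, erasureSymbol]
  · rw [Subsingleton.elim w 0, Subsingleton.elim w' 0]
    simp [withTrivialShield, erasedState, eraseBob, embedBob, erasureSymbol,
      privateMatrix_apply, maxEntangled_apply]

end OneWayKey

/-- For `p ∈ [0,1)` and `d ≥ 2`, the erased state has zero probabilistic one-way distillable secret
key, and it is the erased private state obtained from a private state of `log₂ d` secret key bits
with one-dimensional shield systems. -/
theorem corollary1 (p : ℝ) (hp : p ∈ Set.Ico (0 : ℝ) 1) (d : ℕ) (hd : 2 ≤ d) :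
    OneWayKey.distillableKey (OneWayKey.erasedState p d) = 0 ∧
    ∃ γ : Matrix ((Fin d × Fin 1) × (Fin d × Fin 1)) ((Fin d × Fin 1) × (Fin d × Fin 1)) ℂ,
      OneWayKey.IsPrivateState d 1 1 γ ∧
      Matrix.reindex
        (Equiv.prodCongr (OneWayKey.withTrivialShield d)
          (Equiv.optionCongr (OneWayKey.withTrivialShield d)))
        (Equiv.prodCongr (OneWayKey.withTrivialShield d)
          (Equiv.optionCongr (OneWayKey.withTrivialShield d)))
        (OneWayKey.erasedState p d) = OneWayKey.eraseBob p γ :=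
  ⟨OneWayKey.distillableKey_erasedState hp (by omega),
    OneWayKey.privateMatrix d 1 1 (fun _ => 1) 1,
    ⟨by omega, fun _ => 1, 1, ⟨Matrix.PosSemidef.one, by simp⟩, rfl⟩,
    OneWayKey.erasedState_eq_eraseBob p d⟩
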